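/- A finite polygon in $\mathbb{E}^3$ consists of $n\ge 3$ distinct points $v_1,\dots,v_n$ together with the line segments $[v_1,v_2],\dots,[v_{n-1},v_n],[v_n,v_1]$; an infinite polygon consists of distinct points $v_i$ ($i\in\mathbb{Z}$) together with the line segments $[v_i,v_{i+1}]$, such that each compact set meets only finitely many of these segments. A polygonal complex $\mathcal{K}$ in $\mathbb{E}^3$ consists of a set of points (vertices), a set of line segments joining distinct vertices (edges), and a set of polygons (faces) whose vertices and edges are vertices and edges of $\mathcal{K}$, such that: (a) the graph of vertices and edges is connected; (b) for each vertex $v$ the vertex-figure (the graph on the neighbours of $v$ in which $u,w$ are joined whenever $[u,v]$ and $[v,w]$ are edges of a common face) is connected; (c) each edge lies in exactly $r$ faces, for a fixed $r\ge 2$; (d) each compact set meets only finitely many faces. If $r=2$, then $\mathcal{K}$ is called a polyhedron. The symmetry group $G(\mathcal{K})$ consists of all isometries of the affine hull of $\mathcal{K}$ that map $\mathcal{K}$ to itself. A flag is a triple $\{F_0,F_1,F_2\}$ of a mutually incident vertex, edge and face. The complex $\mathcal{K}$ is regular if $G(\mathcal{K})$ is transitive on the flags, and simply flag-transitive if $G(\mathcal{K})$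 is simply transitive on the flags. A simply flag-transitive regular complex has mirror vector $(j,k)$ if, for a base flag $\{F_0,F_1,F_2\}$, the stabilizer of $\{F_1,F_2\}$ in $G(\mathcal{K})$ is generated by an element $R_0$, and the stabilizer of $\{F_0,F_2\}$ by an element $R_1$, whose mirrors (fixed point sets) have dimensions $j$ and $k$, respectively. **Theorem.** Apart from polyhedra, there are no simply flag-transitive regular polygonal complexes in $\mathbb{E}^3$ with infinite faces and mirror vector $(1,2)$. That is, every simply flag-transitive regular polygonal complex in $\mathbb{E}^3$ all of whose faces are infinite polygons and whose mirror vector is $(1,2)$ satisfies $r=2$. -/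

import Mathlib

/-- Euclidean 3-space. -/
abbrev E3 : Type := EuclideanSpace ℝ (Fin 3)

/-- A line segment with distinct end points `a`, `b` is recorded by the unordered pair `s(a, b)`,
a polygon by the set of its edges. This is the point set covered by the edges in `f`. -/
def polygonCarrier (f : Set (Sym2 E3)) : Set E3 :=
  {x | ∃ a b : E3, s(a, b) ∈ f ∧ x ∈ segment ℝ a b}

/-- `f` is the edge set of an `n`-gon for some `n ≥ 3`: distinct points, cyclically joined. -/
def IsFinitePolygon (f : Set (Sym2 E3)) : Prop :=
  ∃ n : ℕ, 3 ≤ n ∧ ∃ v : ZMod n → E3, Function.Injective v ∧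
    f = Set.range fun i => s(v i, v (i + 1))

/-- `f` is the edge set of an infinite polygon: a two-sided sequence of distinct points, with
successive points joined, such that a compact set meets only finitely many of the segments. -/
def IsInfinitePolygon (f : Set (Sym2 E3)) : Prop :=
  ∃ v : ℤ → E3, Function.Injective v ∧
    (∀ C : Set E3, IsCompact C → {i : ℤ | (segment ℝ (v i) (v (i + 1)) ∩ C).Nonempty}.Finite) ∧
    f = Set.range fun i => s(v i, v (i + 1))

/-- The edge graph of a vertex set `V` and an edge set `E`. -/
def edgeGraph (V : Set E3) (E : Set (Sym2 E3)) : SimpleGraph V where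
  Adj u w := u ≠ w ∧ s((u : E3), (w : E3)) ∈ E
  symm := ⟨fun _ _ h => ⟨h.1.symm, by rw [Sym2.eq_swap]; exact h.2⟩⟩
  loopless := ⟨fun _ h => h.1 rfl⟩

/-- The vertex-figure at `v` of a family with edge set `E` and face set `F`: its vertices are the
neighbors of `v`, and `u`, `w` are joined whenever `(u, v)` and `(v, w)` are edges of a common face.
Only its connectedness is used, so multiplicities of its edges are not recorded. -/
def vertexFigure (E : Set (Sym2 E3)) (F : Set (Set (Sym2 E3))) (v : E3) :
    SimpleGraph {u : E3 // s(v, u) ∈ E} where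
  Adj u w := u ≠ w ∧ ∃ f ∈ F, s(v, (u : E3)) ∈ f ∧ s(v, (w : E3)) ∈ f
  symm := ⟨fun _ _ h => ⟨h.1.symm, by obtain ⟨f, hf, hu, hw⟩ := h.2; exact ⟨f, hf, hw, hu⟩⟩⟩
  loopless := ⟨fun _ h => h.1 rfl⟩

/-- A polygonal complex in Euclidean 3-space, with `r` faces around each edge. -/
structure PolygonalComplex where
  vertices : Set E3
  edges : Set (Sym2 E3)
  faces : Set (Set (Sym2 E3))
  r : ℕ
  edge_not_isDiag : ∀ e ∈ edges, ¬ e.IsDiag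
  mem_vertices_of_mem_edge : ∀ e ∈ edges, ∀ x ∈ e, x ∈ vertices
  face_isPolygon : ∀ f ∈ faces, IsFinitePolygon f ∨ IsInfinitePolygon f
  face_subset_edges : ∀ f ∈ faces, f ⊆ edges
  edgeGraph_connected : (edgeGraph vertices edges).Connected
  vertexFigure_connected : ∀ v ∈ vertices, (vertexFigure edges faces v).Connected
  two_le_r : 2 ≤ r
  encard_faces_of_edge : ∀ e ∈ edges, {f ∈ faces | e ∈ f}.encard = r
  discrete : ∀ C : Set E3, IsCompact C → {f ∈ faces | (polygonCarrier f ∩ C).Nonempty}.Finite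

namespace PolygonalComplex

/-- A (geometric) polyhedron is a polygonal complex with `r = 2`. -/
def IsPolyhedron (K : PolygonalComplex) : Prop := K.r = 2

/-- All faces are infinite polygons. -/
def HasInfiniteFaces (K : PolygonalComplex) : Prop := ∀ f ∈ K.faces, IsInfinitePolygon f

/-- The affine hull of the complex. -/
noncomputable def hull (K : PolygonalComplex) : AffineSubspace ℝ E3 := affineSpan ℝ K.vertices

open Classical in
/-- The effect on points of an isometry of the affine hull (all points that matter lie in the
hull; the other points are left alone so that this is a permutation of the whole space). -/
noncomputable def onPoint (K : PolygonalComplex) (g : K.hull ≃ᵢ K.hull) : Equiv.Perm E3 :=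
  Equiv.Perm.ofSubtype (p := fun x => x ∈ K.hull) g.toEquiv

/-- The effect on edges of an isometry of the affine hull. -/
noncomputable def onEdge (K : PolygonalComplex) (g : K.hull ≃ᵢ K.hull) (e : Sym2 E3) : Sym2 E3 :=
  e.map (K.onPoint g)

/-- The effect on polygons of an isometry of the affine hull. -/
noncomputable def onFace (K : PolygonalComplex) (g : K.hull ≃ᵢ K.hull) (f : Set (Sym2 E3)) :
    Set (Sym2 E3) :=
  K.onEdge g '' f

theorem onPoint_apply (K : PolygonalComplex) (g : K.hull ≃ᵢ K.hull) (x : K.hull) :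
    K.onPoint g (x : E3) = (g x : E3) := by
  classical
  exact Equiv.Perm.ofSubtype_apply_coe (p := fun x => x ∈ K.hull) g.toEquiv x

theorem onPoint_one (K : PolygonalComplex) : K.onPoint 1 = 1 := by
  classical
  exact map_one (Equiv.Perm.ofSubtype (p := fun x => x ∈ K.hull))

theorem onPoint_mul (K : PolygonalComplex) (g h : K.hull ≃ᵢ K.hull) :
    K.onPoint (g * h) = K.onPoint g * K.onPoint h := by
  classical
  exact map_mul (Equiv.Perm.ofSubtype (p := fun x => x ∈ K.hull)) g.toEquiv h.toEquiv

theorem onEdge_one (K : PolygonalComplex) : K.onEdge 1 = id := by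
  funext e
  simp only [onEdge, onPoint_one, Equiv.Perm.coe_one, Sym2.map_id]

theorem onEdge_mul (K : PolygonalComplex) (g h : K.hull ≃ᵢ K.hull) :
    K.onEdge (g * h) = K.onEdge g ∘ K.onEdge h := by
  funext e
  simp only [onEdge, onPoint_mul, Equiv.Perm.coe_mul, Sym2.map_comp, Function.comp_apply]

theorem onFace_one (K : PolygonalComplex) : K.onFace 1 = id := by
  funext f
  rw [onFace, onEdge_one, Set.image_id, id]

theorem onFace_mul (K : PolygonalComplex) (g h : K.hull ≃ᵢ K.hull) :
    K.onFace (g * h) = K.onFace g ∘ K.onFace h := by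
  funext f
  rw [onFace, onEdge_mul, Set.image_comp, Function.comp_apply, onFace, onFace]

/-- The symmetry group `G(K)`: all isometries of the affine hull of `K` that map `K` to itself. -/
def symmetryGroup (K : PolygonalComplex) : Subgroup (K.hull ≃ᵢ K.hull) where
  carrier := {g | K.onPoint g '' K.vertices = K.vertices ∧ K.onEdge g '' K.edges = K.edges ∧
    K.onFace g '' K.faces = K.faces}
  one_mem' := by
    refine ⟨?_, ?_, ?_⟩
    · rw [onPoint_one, Equiv.Perm.coe_one, Set.image_id]
    · rw [onEdge_one, Set.image_id]
    · rw [onFace_one, Set.image_id]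
  mul_mem' := by
    rintro g h ⟨g0, g1, g2⟩ ⟨h0, h1, h2⟩
    refine ⟨?_, ?_, ?_⟩
    · rw [onPoint_mul, Equiv.Perm.coe_mul, Set.image_comp, h0, g0]
    · rw [onEdge_mul, Set.image_comp, h1, g1]
    · rw [onFace_mul, Set.image_comp, h2, g2]
  inv_mem' := by
    rintro g ⟨g0, g1, g2⟩
    refine ⟨?_, ?_, ?_⟩
    · conv_lhs => rw [← g0]
      rw [← Set.image_comp, ← Equiv.Perm.coe_mul, ← onPoint_mul, inv_mul_cancel, onPoint_one,
        Equiv.Perm.coe_one, Set.image_id]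
    · conv_lhs => rw [← g1]
      rw [← Set.image_comp, ← onEdge_mul, inv_mul_cancel, onEdge_one, Set.image_id]
    · conv_lhs => rw [← g2]
      rw [← Set.image_comp, ← onFace_mul, inv_mul_cancel, onFace_one, Set.image_id]

/-- A flag: mutually incident vertex, edge and face. -/
structure Flag (K : PolygonalComplex) where
  vertex : E3
  edge : Sym2 E3
  face : Set (Sym2 E3)
  vertex_mem : vertex ∈ K.vertices
  edge_mem : edge ∈ K.edges
  face_mem : face ∈ K.faces
  vertex_mem_edge : vertex ∈ edge
  edge_mem_face : edge ∈ face

/-- The isometry `g` maps the flag `Φ` to the flag `Ψ`. -/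
def MapsFlag (K : PolygonalComplex) (g : K.hull ≃ᵢ K.hull) (Φ Ψ : K.Flag) : Prop :=
  K.onPoint g Φ.vertex = Ψ.vertex ∧ K.onEdge g Φ.edge = Ψ.edge ∧ K.onFace g Φ.face = Ψ.face

/-- The symmetry group is transitive on the flags. -/
def IsRegular (K : PolygonalComplex) : Prop :=
  ∀ Φ Ψ : K.Flag, ∃ g ∈ K.symmetryGroup, K.MapsFlag g Φ Ψ

/-- The full symmetry group is simply transitive on the flags. -/
def IsSimplyFlagTransitive (K : PolygonalComplex) : Prop :=
  ∀ Φ Ψ : K.Flag, ∃! g : K.hull ≃ᵢ K.hull, g ∈ K.symmetryGroup ∧ K.MapsFlag g Φ Ψ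

/-- The subgroup `G₀` for the base flag `Φ`: symmetries fixing its edge and its face. -/
def G₀ (K : PolygonalComplex) (Φ : K.Flag) : Subgroup (K.hull ≃ᵢ K.hull) where
  carrier := {g | g ∈ K.symmetryGroup ∧ K.onEdge g Φ.edge = Φ.edge ∧ K.onFace g Φ.face = Φ.face}
  one_mem' := ⟨one_mem _, by rw [onEdge_one, id], by rw [onFace_one, id]⟩
  mul_mem' := by
    rintro g h ⟨g0, g1, g2⟩ ⟨h0, h1, h2⟩
    exact ⟨mul_mem g0 h0, by rw [onEdge_mul, Function.comp_apply, h1, g1],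
      by rw [onFace_mul, Function.comp_apply, h2, g2]⟩
  inv_mem' := by
    rintro g ⟨g0, g1, g2⟩
    refine ⟨inv_mem g0, ?_, ?_⟩
    · conv_lhs => rw [← g1]
      rw [← Function.comp_apply (f := K.onEdge g⁻¹), ← onEdge_mul, inv_mul_cancel, onEdge_one, id]
    · conv_lhs => rw [← g2]
      rw [← Function.comp_apply (f := K.onFace g⁻¹), ← onFace_mul, inv_mul_cancel, onFace_one, id]

/-- The subgroup `G₁` for the base flag `Φ`: symmetries fixing its vertex and its face. -/
def G₁ (K : PolygonalComplex) (Φ : K.Flag) : Subgroup (K.hull ≃ᵢ K.hull) where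
  carrier := {g | g ∈ K.symmetryGroup ∧ K.onPoint g Φ.vertex = Φ.vertex ∧
    K.onFace g Φ.face = Φ.face}
  one_mem' := ⟨one_mem _, by rw [onPoint_one, Equiv.Perm.coe_one, id], by rw [onFace_one, id]⟩
  mul_mem' := by
    rintro g h ⟨g0, g1, g2⟩ ⟨h0, h1, h2⟩
    exact ⟨mul_mem g0 h0, by rw [onPoint_mul, Equiv.Perm.mul_apply, h1, g1],
      by rw [onFace_mul, Function.comp_apply, h2, g2]⟩
  inv_mem' := by
    rintro g ⟨g0, g1, g2⟩
    refine ⟨inv_mem g0, ?_, ?_⟩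
    · conv_lhs => rw [← g1]
      rw [← Equiv.Perm.mul_apply, ← onPoint_mul, inv_mul_cancel, onPoint_one, Equiv.Perm.coe_one,
        id]
    · conv_lhs => rw [← g2]
      rw [← Function.comp_apply (f := K.onFace g⁻¹), ← onFace_mul, inv_mul_cancel, onFace_one, id]

/-- The mirror (fixed point set) of an isometry of the affine hull, as a subset of space. -/
def mirror (K : PolygonalComplex) (g : K.hull ≃ᵢ K.hull) : Set E3 :=
  {x | ∃ y : K.hull, g y = y ∧ (y : E3) = x}

/-- The mirror of `g` is non-empty of dimension `d`. -/
def HasMirrorDim (K : PolygonalComplex) (g : K.hull ≃ᵢ K.hull) (d : ℕ) : Prop :=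
  (K.mirror g).Nonempty ∧ Module.finrank ℝ (vectorSpan ℝ (K.mirror g)) = d

/-- With respect to some base flag, `G₀ = ⟨R₀⟩` and `G₁ = ⟨R₁⟩`, where the mirrors of `R₀` and `R₁`
have dimensions `j` and `k`. -/
def HasMirrorVector (K : PolygonalComplex) (j k : ℕ) : Prop :=
  ∃ (Φ : K.Flag) (R₀ R₁ : K.hull ≃ᵢ K.hull),
    K.G₀ Φ = Subgroup.zpowers R₀ ∧ K.G₁ Φ = Subgroup.zpowers R₁ ∧
    K.HasMirrorDim R₀ j ∧ K.HasMirrorDim R₁ k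

end PolygonalComplex

/-- Two injective two-sided sequences with the same steps and the same first step agree. -/
theorem int_path_unique {X : Type*} {v w : ℤ → X} (hv : Function.Injective v)
    (hw : Function.Injective w)
    (h : Set.range (fun i => s(w i, w (i + 1))) ⊆ Set.range fun i => s(v i, v (i + 1)))
    (h0 : w 0 = v 0) (h1 : w 1 = v 1) : w = v := by
  have key : ∀ i j : ℤ, s(w i, w (i + 1)) = s(v j, v (j + 1)) →
      (w i = v j ∧ w (i + 1) = v (j + 1)) ∨ (w i = v (j + 1) ∧ w (i + 1) = v j) := by
    intro i j hij
    simpa using hij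
  have up : ∀ n : ℕ, w n = v n ∧ w (n + 1) = v (n + 1) := by
    intro n
    induction n with
    | zero => simpa using ⟨h0, h1⟩
    | succ n ih =>
      push_cast
      refine ⟨ih.2, ?_⟩
      obtain ⟨j, hj⟩ := h ⟨(n : ℤ) + 1, rfl⟩
      rcases key _ _ hj.symm with ⟨a, b⟩ | ⟨a, b⟩
      · have : j = n + 1 := hv (a.symm.trans ih.2)
        rw [b, this]
      · have e : j + 1 = n + 1 := hv (a.symm.trans ih.2)
        have e' : j = n := by omega
        rw [e', ← ih.1] at b
        have := hw b
        omega
  have down : ∀ n : ℕ, w (-n) = v (-n) ∧ w (-n + 1) = v (-n + 1) := by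
    intro n
    induction n with
    | zero => simpa using ⟨h0, h1⟩
    | succ n ih =>
      have e1 : (-((n + 1 : ℕ) : ℤ)) + 1 = -n := by push_cast; ring
      rw [e1]
      refine ⟨?_, ih.1⟩
      obtain ⟨j, hj⟩ := h ⟨-((n + 1 : ℕ) : ℤ), rfl⟩
      rcases key _ _ hj.symm with ⟨a, b⟩ | ⟨a, b⟩
      · rw [e1] at b
        have e : j + 1 = -n := hv (b.symm.trans ih.1)
        rw [a]
        congr 1
        push_cast
        omega
      · rw [e1] at b
        have e : j = -n := hv (b.symm.trans ih.1)
        rw [e, ← ih.2] at a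
        have := hw a
        push_cast at this
        omega
  funext i
  rcases Int.eq_nat_or_neg i with ⟨n, rfl | rfl⟩
  · exact (up n).1
  · exact (down n).1

/-- An infinite polygon can be traversed starting with a given vertex and a given edge. -/
theorem IsInfinitePolygon.exists_param {f : Set (Sym2 E3)} (hf : IsInfinitePolygon f) {x : E3}
    {e : Sym2 E3} (hx : x ∈ e) (he : e ∈ f) :
    ∃ v : ℤ → E3, Function.Injective v ∧
      (∀ C : Set E3, IsCompact C → {i : ℤ | v i ∈ C}.Finite) ∧
      (f = Set.range fun i => s(v i, v (i + 1))) ∧ v 0 = x ∧ e = s(v 0, v 1) := by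
  obtain ⟨v, hv, hc, rfl⟩ := hf
  have hc' : ∀ C : Set E3, IsCompact C → {i : ℤ | v i ∈ C}.Finite := fun C hC =>
    (hc C hC).subset fun i hi => ⟨v i, left_mem_segment ℝ _ _, hi⟩
  obtain ⟨k, rfl⟩ := he
  rcases Sym2.mem_iff.1 hx with rfl | rfl
  · refine ⟨fun i => v (k + i), fun i j h => by simpa using hv h, fun C hC =>
      (hc' C hC).preimage (f := fun i : ℤ => k + i) (fun i _ j _ h => by simpa using h), ?_,
      by simp, by simp⟩
    ext e
    constructor
    · rintro ⟨i, rfl⟩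
      exact ⟨i - k, by ring_nf⟩
    · rintro ⟨i, rfl⟩
      exact ⟨k + i, by ring_nf⟩
  · refine ⟨fun i => v (k + 1 - i), fun i j h => by simpa using hv h, fun C hC =>
      (hc' C hC).preimage (f := fun i : ℤ => k + 1 - i) (fun i _ j _ h => by simpa using h), ?_,
      by simp, ?_⟩
    · ext e
      constructor
      · rintro ⟨i, rfl⟩
        refine ⟨k - i, ?_⟩
        beta_reduce
        rw [Sym2.eq_swap]
        ring_nf
      · rintro ⟨i, rfl⟩
        refine ⟨k - i, ?_⟩
        beta_reduce
        rw [Sym2.eq_swap]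
        ring_nf
    · rw [Sym2.eq_swap]
      simp

/-- Points at equal distance from all points of `S` differ by a vector orthogonal to `S`. -/
theorem sub_mem_orthogonal_vectorSpan {V : Type*} [NormedAddCommGroup V] [InnerProductSpace ℝ V]
    {S : Set V} {x y : V} (h : ∀ p ∈ S, dist y p = dist x p) :
    y - x ∈ (vectorSpan ℝ S)ᗮ := by
  rw [Submodule.mem_orthogonal]
  intro z hz
  rw [vectorSpan_def] at hz
  induction hz using Submodule.span_induction with
  | mem z hz =>
    obtain ⟨p, hp, q, hq, rfl⟩ := hz
    have e : ∀ p ∈ S, inner ℝ (y - p) (y - p) = inner ℝ (x - p) (x - p) := by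
      intro p hp
      rw [real_inner_self_eq_norm_sq, real_inner_self_eq_norm_sq, ← dist_eq_norm, ← dist_eq_norm,
        h p hp]
    have e1 := e p hp
    have e2 := e q hq
    simp only [inner_sub_left, inner_sub_right, vsub_eq_sub] at e1 e2 ⊢
    rw [real_inner_comm y p, real_inner_comm x p] at *
    rw [real_inner_comm y q, real_inner_comm x q] at *
    linarith
  | zero => simp
  | add a b _ _ ha hb => rw [inner_add_left, ha, hb, add_zero]
  | smul c a _ ha => rw [inner_smul_left, ha, mul_zero]

/-- A linear isometry of order two is `-1` on the complement of its space of fixed vectors. -/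
theorem involution_apply_of_mem_orthogonal {V : Type*} [NormedAddCommGroup V]
    [InnerProductSpace ℝ V] {A : V ≃ₗᵢ[ℝ] V} (hA : ∀ x, A (A x) = x) {U : Submodule ℝ V}
    (hU : ∀ x, x ∈ U ↔ A x = x) {z : V} (hz : z ∈ Uᗮ) : A z = -z := by
  have h1 : A z + z ∈ U := by rw [hU, map_add, hA, add_comm]
  have h2 : A z + z ∈ Uᗮ := by
    refine add_mem ?_ hz
    rw [Submodule.mem_orthogonal] at hz ⊢
    intro u hu
    rw [← (hU u).1 hu, A.inner_map_map]
    exact hz u hu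
  have h3 := Submodule.inf_orthogonal_eq_bot U
  have : A z + z ∈ U ⊓ Uᗮ := ⟨h1, h2⟩
  rw [h3, Submodule.mem_bot] at this
  exact eq_neg_of_add_eq_zero_left this

/-- A linear half-turn `A` commutes with an isometry `B` which moves all vectors at right angles to
a space of fixed vectors that contains the axis of `A`. -/
theorem involution_comm {V : Type*} [NormedAddCommGroup V] [InnerProductSpace ℝ V]
    {A B : V ≃ₗᵢ[ℝ] V} (hA : ∀ x, A (A x) = x) {U W : Submodule ℝ V}
    (hU : ∀ x, x ∈ U ↔ A x = x) (hW : ∀ x ∈ W, B x = x) (hB : ∀ x, B x - x ∈ Wᗮ) (hUW : U ≤ W)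
    (x : V) : A (B x) = B (A x) := by
  have h1 := involution_apply_of_mem_orthogonal hA hU (Submodule.orthogonal_le hUW (hB x))
  have h2 : A x + x ∈ U := by rw [hU, map_add, hA, add_comm]
  have h3 := hW _ (hUW h2)
  rw [map_sub] at h1
  rw [map_add] at h3
  have e1 : A (B x) = A x - B x + x := by rw [← sub_add_cancel (A (B x)) (A x), h1]; abel
  have e2 : B (A x) = A x + x - B x := by rw [← h3]; abel
  rw [e1, e2]
  abel

namespace PolygonalComplex

variable {K : PolygonalComplex}

theorem onPoint_injective : Function.Injective K.onPoint := by
  intro g h hgh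
  ext x
  have := congrArg (fun p : Equiv.Perm E3 => p x) hgh
  simp only [onPoint_apply] at this
  rw [this]

theorem dist_onPoint (hK : K.hull = ⊤) (g : K.hull ≃ᵢ K.hull) (x y : E3) :
    dist (K.onPoint g x) (K.onPoint g y) = dist x y := by
  have hx : x ∈ K.hull := by rw [hK]; trivial
  have hy : y ∈ K.hull := by rw [hK]; trivial
  have h1 := K.onPoint_apply g ⟨x, hx⟩
  have h2 := K.onPoint_apply g ⟨y, hy⟩
  simp only at h1 h2
  rw [h1, h2]
  exact g.dist_eq ⟨x, hx⟩ ⟨y, hy⟩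

theorem exists_onPoint_eq (hK : K.hull = ⊤) (T : E3 ≃ᵢ E3) :
    ∃ g : K.hull ≃ᵢ K.hull, ∀ x, K.onPoint g x = T x := by
  have hx : ∀ x, x ∈ K.hull := by intro x; rw [hK]; trivial
  refine ⟨⟨⟨fun x => ⟨T x, hx _⟩, fun x => ⟨T.symm x, hx _⟩, fun x => by simp, fun x => by simp⟩,
    fun x y => T.isometry.edist_eq _ _⟩, fun x => ?_⟩
  exact K.onPoint_apply _ ⟨x, hx x⟩

/-- The linear part of an isometry. -/
theorem exists_linear_part (hK : K.hull = ⊤) (g : K.hull ≃ᵢ K.hull) :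
    ∃ A : E3 ≃ₗᵢ[ℝ] E3, ∀ x y, K.onPoint g x - K.onPoint g y = A (x - y) := by
  let T : E3 ≃ᵢ E3 := ⟨K.onPoint g, Isometry.of_dist_eq (dist_onPoint hK g)⟩
  refine ⟨T.toRealAffineIsometryEquiv.linearIsometryEquiv, fun x y => ?_⟩
  exact (T.toRealAffineIsometryEquiv.map_vsub x y).symm

theorem mem_mirror_iff (hK : K.hull = ⊤) (g : K.hull ≃ᵢ K.hull) (x : E3) :
    x ∈ K.mirror g ↔ K.onPoint g x = x := by
  have hx : x ∈ K.hull := by rw [hK]; trivial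
  constructor
  · rintro ⟨y, hy, rfl⟩
    rw [onPoint_apply, hy]
  · intro h
    refine ⟨⟨x, hx⟩, Subtype.ext ?_, rfl⟩
    rw [← onPoint_apply]
    exact h

theorem mem_vectorSpan_mirror_iff (hK : K.hull = ⊤) {g : K.hull ≃ᵢ K.hull}
    (hne : (K.mirror g).Nonempty) {A : E3 ≃ₗᵢ[ℝ] E3}
    (hA : ∀ x y, K.onPoint g x - K.onPoint g y = A (x - y)) (z : E3) :
    z ∈ vectorSpan ℝ (K.mirror g) ↔ A z = z := by
  constructor
  · intro hz
    rw [vectorSpan_def] at hz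
    induction hz using Submodule.span_induction with
    | mem z hz =>
      obtain ⟨p, hp, q, hq, rfl⟩ := hz
      rw [mem_mirror_iff hK] at hp hq
      beta_reduce
      rw [vsub_eq_sub, ← hA, hp, hq]
    | zero => simp
    | add a b _ _ ha hb => rw [map_add, ha, hb]
    | smul c a _ ha => rw [map_smul, ha]
  · intro hz
    obtain ⟨p, hp⟩ := hne
    have hpz : z + p ∈ K.mirror g := by
      rw [mem_mirror_iff hK] at hp ⊢
      have := hA (z + p) p
      rw [add_sub_cancel_right, hz, hp] at this
      exact eq_add_of_sub_eq this
    simpa using vsub_mem_vectorSpan ℝ hpz hp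

/-- A non-trivial isometry of the hull with a mirror of dimension two forces the hull to be the
whole space. -/
theorem hull_eq_top_of_hasMirrorDim_two {g : K.hull ≃ᵢ K.hull} (hg : g ≠ 1)
    (h : K.HasMirrorDim g 2) : K.hull = ⊤ := by
  obtain ⟨⟨p, hp⟩, hd⟩ := h
  have hsub : K.mirror g ⊆ K.hull := by
    rintro _ ⟨y, -, rfl⟩
    exact y.2
  have hle : vectorSpan ℝ (K.mirror g) ≤ K.hull.direction := vectorSpan_mono ℝ hsub
  have hne : (K.hull : Set E3).Nonempty := ⟨p, hsub hp⟩
  rw [← AffineSubspace.direction_eq_top_iff_of_nonempty hne]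
  by_contra hdir
  have hlt : Module.finrank ℝ K.hull.direction < 3 := by
    have := Submodule.finrank_lt hdir
    rwa [finrank_euclideanSpace_fin] at this
  have heq : vectorSpan ℝ (K.mirror g) = K.hull.direction :=
    Submodule.eq_of_le_of_finrank_le hle (by omega)
  apply hg
  ext x : 1
  apply Subtype.ext
  have h1 : (g x : E3) - x ∈ (vectorSpan ℝ (K.mirror g))ᗮ := by
    apply sub_mem_orthogonal_vectorSpan
    rintro _ ⟨y, hy, rfl⟩
    have := g.dist_eq x y
    rw [hy] at this
    exact this
  have h2 : (g x : E3) - x ∈ vectorSpan ℝ (K.mirror g) := by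
    rw [heq]
    exact AffineSubspace.vsub_mem_direction (g x).2 x.2
  have h3 : (g x : E3) - x ∈ vectorSpan ℝ (K.mirror g) ⊓ (vectorSpan ℝ (K.mirror g))ᗮ := ⟨h2, h1⟩
  rw [Submodule.inf_orthogonal_eq_bot, Submodule.mem_bot, sub_eq_zero] at h3
  exact h3

end PolygonalComplex

/-- A property of integers stable under `i ↦ -i` and `i ↦ 1 - i` holds everywhere if it holds
at `0`. -/
theorem Int.forall_of_neg_of_one_sub {P : ℤ → Prop} (h0 : P 0) (hneg : ∀ i, P i → P (-i))
    (hsub : ∀ i, P i → P (1 - i)) (i : ℤ) : P i := by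
  induction i using Int.induction_on with
  | zero => exact h0
  | succ n ih => simpa [add_comm] using hsub _ (hneg _ ih)
  | pred n ih =>
    have h : -(n : ℤ) - 1 = -(1 - -(n : ℤ)) := by ring
    rw [h]
    exact hneg _ (hsub _ ih)

theorem SimpleGraph.Connected.forall_of_adj {V : Type*} {G : SimpleGraph V} (hG : G.Connected)
    {P : V → Prop} (h : ∀ u w, G.Adj u w → P u → P w) {a : V} (ha : P a) (b : V) : P b := by
  obtain ⟨p⟩ := hG.preconnected a b
  induction p with
  | nil => exact ha
  | cons hadj _ ih => exact ih (h _ _ hadj ha)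

namespace PolygonalComplex

variable {K : PolygonalComplex}

theorem onPoint_mem {g : K.hull ≃ᵢ K.hull} (hg : g ∈ K.symmetryGroup) {x : E3}
    (hx : x ∈ K.vertices) : K.onPoint g x ∈ K.vertices :=
  hg.1 ▸ Set.mem_image_of_mem _ hx

theorem onEdge_mem {g : K.hull ≃ᵢ K.hull} (hg : g ∈ K.symmetryGroup) {e : Sym2 E3}
    (he : e ∈ K.edges) : K.onEdge g e ∈ K.edges :=
  hg.2.1 ▸ Set.mem_image_of_mem _ he

theorem onFace_mem {g : K.hull ≃ᵢ K.hull} (hg : g ∈ K.symmetryGroup) {f : Set (Sym2 E3)}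
    (hf : f ∈ K.faces) : K.onFace g f ∈ K.faces :=
  hg.2.2 ▸ Set.mem_image_of_mem _ hf

theorem MapsFlag.mul {g h : K.hull ≃ᵢ K.hull} {Φ Ψ Χ : K.Flag} (hg : K.MapsFlag g Ψ Χ)
    (hh : K.MapsFlag h Φ Ψ) : K.MapsFlag (g * h) Φ Χ := by
  refine ⟨?_, ?_, ?_⟩
  · rw [onPoint_mul, Equiv.Perm.mul_apply, hh.1, hg.1]
  · rw [onEdge_mul, Function.comp_apply, hh.2.1, hg.2.1]
  · rw [onFace_mul, Function.comp_apply, hh.2.2, hg.2.2]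

theorem MapsFlag.one (Φ : K.Flag) : K.MapsFlag 1 Φ Φ := by
  refine ⟨?_, ?_, ?_⟩
  · rw [onPoint_one, Equiv.Perm.coe_one, id]
  · rw [onEdge_one, id]
  · rw [onFace_one, id]

theorem MapsFlag.inv {g : K.hull ≃ᵢ K.hull} {Φ Ψ : K.Flag} (hg : K.MapsFlag g Φ Ψ) :
    K.MapsFlag g⁻¹ Ψ Φ := by
  refine ⟨?_, ?_, ?_⟩
  · rw [← hg.1, ← Equiv.Perm.mul_apply, ← onPoint_mul, inv_mul_cancel, onPoint_one,
      Equiv.Perm.coe_one, id]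
  · rw [← hg.2.1, ← Function.comp_apply (f := K.onEdge g⁻¹), ← onEdge_mul, inv_mul_cancel,
      onEdge_one, id]
  · rw [← hg.2.2, ← Function.comp_apply (f := K.onFace g⁻¹), ← onFace_mul, inv_mul_cancel,
      onFace_one, id]

theorem exists_face_of_edge {e : Sym2 E3} (he : e ∈ K.edges) : ∃ f ∈ K.faces, e ∈ f := by
  have h := K.encard_faces_of_edge e he
  have hne : {f ∈ K.faces | e ∈ f}.Nonempty := by
    rw [← Set.encard_ne_zero, h]
    have := K.two_le_r
    exact_mod_cast (by omega : K.r ≠ 0)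
  exact hne

theorem exists_edge_of_face (hinf : K.HasInfiniteFaces) {f : Set (Sym2 E3)} (hf : f ∈ K.faces) :
    ∃ e, e ∈ f := by
  obtain ⟨v, -, -, rfl⟩ := hinf f hf
  exact ⟨_, 0, rfl⟩

/-- If a flag `Ψ` is the image of `Φ` under the subgroup `H`, then so is a flag `Ψ'` such that the
conjugate to `Φ` of each symmetry that takes `Ψ` to `Ψ'` lies in `H`. -/
theorem mapsFlag_step (hreg : K.IsRegular) {H : Subgroup (K.hull ≃ᵢ K.hull)}
    (hH : H ≤ K.symmetryGroup) {Φ Ψ Ψ' : K.Flag}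
    (hstep : ∀ h g, g ∈ K.symmetryGroup → h ∈ H → K.MapsFlag h Φ Ψ → K.MapsFlag g Ψ Ψ' →
      h⁻¹ * (g * h) ∈ K.symmetryGroup → h⁻¹ * (g * h) ∈ H)
    (hΨ : ∃ h ∈ H, K.MapsFlag h Φ Ψ) : ∃ h ∈ H, K.MapsFlag h Φ Ψ' := by
  obtain ⟨h, hh, hm⟩ := hΨ
  obtain ⟨g, hg, hm'⟩ := hreg Ψ Ψ'
  refine ⟨g * h, ?_, hm'.mul hm⟩
  have := hstep h g hg hh hm hm' (mul_mem (inv_mem (hH hh)) (mul_mem hg (hH hh)))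
  have := mul_mem hh this
  rwa [mul_inv_cancel_left] at this

/-- A group of symmetries which contains the stabilizers of the three pairs of elements of a flag
is transitive on the flags; moreover each vertex lies in a flag. -/
theorem flag_transitive_of_stabilizers_le (hreg : K.IsRegular)
    {H : Subgroup (K.hull ≃ᵢ K.hull)} (hH : H ≤ K.symmetryGroup) (Φ : K.Flag)
    (h0 : K.G₀ Φ ≤ H) (h1 : K.G₁ Φ ≤ H)
    (h2 : ∀ g ∈ K.symmetryGroup, K.onPoint g Φ.vertex = Φ.vertex → K.onEdge g Φ.edge = Φ.edge →
      g ∈ H) :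
    (∀ Ψ : K.Flag, ∃ h ∈ H, K.MapsFlag h Φ Ψ) ∧ ∀ x ∈ K.vertices, ∃ Ψ : K.Flag, Ψ.vertex = x := by
  have vert : ∀ {h g : K.hull ≃ᵢ K.hull} {Ψ Ψ' : K.Flag}, K.MapsFlag h Φ Ψ → K.MapsFlag g Ψ Ψ' →
      Ψ.vertex = Ψ'.vertex → K.onPoint (h⁻¹ * (g * h)) Φ.vertex = Φ.vertex := by
    intro h g Ψ Ψ' hm hm' e
    rw [onPoint_mul, Equiv.Perm.mul_apply, (hm'.mul hm).1, ← e, hm.inv.1]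
  have edge : ∀ {h g : K.hull ≃ᵢ K.hull} {Ψ Ψ' : K.Flag}, K.MapsFlag h Φ Ψ → K.MapsFlag g Ψ Ψ' →
      Ψ.edge = Ψ'.edge → K.onEdge (h⁻¹ * (g * h)) Φ.edge = Φ.edge := by
    intro h g Ψ Ψ' hm hm' e
    rw [onEdge_mul, Function.comp_apply, (hm'.mul hm).2.1, ← e, hm.inv.2.1]
  have face : ∀ {h g : K.hull ≃ᵢ K.hull} {Ψ Ψ' : K.Flag}, K.MapsFlag h Φ Ψ → K.MapsFlag g Ψ Ψ' →
      Ψ.face = Ψ'.face → K.onFace (h⁻¹ * (g * h)) Φ.face = Φ.face := by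
    intro h g Ψ Ψ' hm hm' e
    rw [onFace_mul, Function.comp_apply, (hm'.mul hm).2.2, ← e, hm.inv.2.2]
  have s0 : ∀ Ψ Ψ' : K.Flag, Ψ.edge = Ψ'.edge → Ψ.face = Ψ'.face →
      (∃ h ∈ H, K.MapsFlag h Φ Ψ) → ∃ h ∈ H, K.MapsFlag h Φ Ψ' := fun Ψ Ψ' ha hb =>
    mapsFlag_step hreg hH fun h g _ _ hm hm' hG => h0 ⟨hG, edge hm hm' ha, face hm hm' hb⟩
  have s1 : ∀ Ψ Ψ' : K.Flag, Ψ.vertex = Ψ'.vertex → Ψ.face = Ψ'.face →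
      (∃ h ∈ H, K.MapsFlag h Φ Ψ) → ∃ h ∈ H, K.MapsFlag h Φ Ψ' := fun Ψ Ψ' ha hb =>
    mapsFlag_step hreg hH fun h g _ _ hm hm' hG => h1 ⟨hG, vert hm hm' ha, face hm hm' hb⟩
  have s2 : ∀ Ψ Ψ' : K.Flag, Ψ.vertex = Ψ'.vertex → Ψ.edge = Ψ'.edge →
      (∃ h ∈ H, K.MapsFlag h Φ Ψ) → ∃ h ∈ H, K.MapsFlag h Φ Ψ' := fun Ψ Ψ' ha hb =>
    mapsFlag_step hreg hH fun h g _ _ hm hm' hG => h2 _ hG (vert hm hm' ha) (edge hm hm' hb)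
  -- from one flag at a vertex to all flags at this vertex
  have around : ∀ Ψ Ψ' : K.Flag, Ψ.vertex = Ψ'.vertex →
      (∃ h ∈ H, K.MapsFlag h Φ Ψ) → ∃ h ∈ H, K.MapsFlag h Φ Ψ' := by
    intro Ψ Ψ' hv hΨ
    obtain ⟨u, hu⟩ : ∃ u, Ψ.edge = s(Ψ.vertex, u) := Ψ.vertex_mem_edge
    obtain ⟨u', hu'⟩ : ∃ u, Ψ'.edge = s(Ψ'.vertex, u) := Ψ'.vertex_mem_edge
    have hue : s(Ψ.vertex, u) ∈ K.edges := hu ▸ Ψ.edge_mem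
    have hue' : s(Ψ.vertex, u') ∈ K.edges := by rw [hv, ← hu']; exact Ψ'.edge_mem
    refine (K.vertexFigure_connected Ψ.vertex Ψ.vertex_mem).forall_of_adj
      (P := fun w => ∀ Χ : K.Flag, Χ.vertex = Ψ.vertex → Χ.edge = s(Ψ.vertex, (w : E3)) →
        ∃ h ∈ H, K.MapsFlag h Φ Χ) ?_ (a := ⟨u, hue⟩) ?_ ⟨u', hue'⟩ Ψ' hv.symm (hu'.trans (by rw [← hv]))
    · rintro ⟨a, ha⟩ ⟨b, hb⟩ ⟨-, f, hf, haf, hbf⟩ hP Χ hΧ hΧe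
      let Α : K.Flag := ⟨Ψ.vertex, s(Ψ.vertex, a), f, Ψ.vertex_mem, ha, hf, by simp, haf⟩
      let Β : K.Flag := ⟨Ψ.vertex, s(Ψ.vertex, b), f, Ψ.vertex_mem, hb, hf, by simp, hbf⟩
      exact s2 Β Χ hΧ.symm hΧe.symm (s1 Α Β rfl rfl (hP Α rfl rfl))
    · intro Χ hΧ hΧe
      exact s2 Ψ Χ hΧ.symm (hu.trans hΧe.symm) hΨ
  have all : ∀ x : K.vertices, (∀ Ψ : K.Flag, Ψ.vertex = x → ∃ h ∈ H, K.MapsFlag h Φ Ψ) ∧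
      ∃ Ψ : K.Flag, Ψ.vertex = x := by
    refine K.edgeGraph_connected.forall_of_adj ?_ (a := ⟨Φ.vertex, Φ.vertex_mem⟩)
      ⟨fun Ψ hΨ => around Φ Ψ hΨ.symm ⟨1, one_mem _, MapsFlag.one _⟩, Φ, rfl⟩
    rintro ⟨a, ha⟩ ⟨b, hb⟩ ⟨-, hab⟩ ⟨hP, -⟩
    obtain ⟨f, hf, hef⟩ := exists_face_of_edge hab
    let Α : K.Flag := ⟨a, s(a, b), f, ha, hab, hf, by simp, hef⟩
    let Β : K.Flag := ⟨b, s(a, b), f, hb, hab, hf, by simp, hef⟩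
    exact ⟨fun Ψ hΨ => around Β Ψ hΨ.symm (s0 Α Β rfl rfl (hP Α rfl)), Β, rfl⟩
  exact ⟨fun Ψ => (all ⟨_, Ψ.vertex_mem⟩).1 Ψ rfl, fun x hx => (all ⟨x, hx⟩).2⟩

/-- An involution that fixes a flag and conjugates the stabilizers of the three pairs of elements
of the flag into the symmetry group is a symmetry. -/
theorem mem_symmetryGroup_of_conj (hreg : K.IsRegular) (hinf : K.HasInfiniteFaces) {Φ : K.Flag}
    {σ : K.hull ≃ᵢ K.hull} (hσ : σ * σ = 1) (hΦ : K.MapsFlag σ Φ Φ)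
    (h0 : ∀ g ∈ K.G₀ Φ, σ * g * σ⁻¹ ∈ K.symmetryGroup)
    (h1 : ∀ g ∈ K.G₁ Φ, σ * g * σ⁻¹ ∈ K.symmetryGroup)
    (h2 : ∀ g ∈ K.symmetryGroup, K.onPoint g Φ.vertex = Φ.vertex → K.onEdge g Φ.edge = Φ.edge →
      σ * g * σ⁻¹ ∈ K.symmetryGroup) : σ ∈ K.symmetryGroup := by
  obtain ⟨htrans, hvert⟩ := flag_transitive_of_stabilizers_le hreg
    (H := K.symmetryGroup ⊓ K.symmetryGroup.comap (MulAut.conj σ).toMonoidHom) inf_le_left Φ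
    (fun g hg => ⟨hg.1, h0 g hg⟩) (fun g hg => ⟨hg.1, h1 g hg⟩)
    (fun g hg ha hb => ⟨hg, h2 g hg ha hb⟩)
  have key : ∀ Ψ : K.Flag, K.onPoint σ Ψ.vertex ∈ K.vertices ∧ K.onEdge σ Ψ.edge ∈ K.edges ∧
      K.onFace σ Ψ.face ∈ K.faces := by
    intro Ψ
    obtain ⟨g, ⟨-, hc⟩, hm⟩ := htrans Ψ
    have hc : σ * g * σ⁻¹ ∈ K.symmetryGroup := hc
    have hcm : σ * g = σ * g * σ⁻¹ * σ := by group
    refine ⟨?_, ?_, ?_⟩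
    · rw [← hm.1, ← Equiv.Perm.mul_apply, ← onPoint_mul, hcm, onPoint_mul, Equiv.Perm.mul_apply,
        hΦ.1]
      exact onPoint_mem hc Φ.vertex_mem
    · rw [← hm.2.1, ← Function.comp_apply (f := K.onEdge σ), ← onEdge_mul, hcm, onEdge_mul,
        Function.comp_apply, hΦ.2.1]
      exact onEdge_mem hc Φ.edge_mem
    · rw [← hm.2.2, ← Function.comp_apply (f := K.onFace σ), ← onFace_mul, hcm, onFace_mul,
        Function.comp_apply, hΦ.2.2]
      exact onFace_mem hc Φ.face_mem
  have image_eq : ∀ {X : Type} {F : X → X} {S : Set X}, F ∘ F = id → (∀ x ∈ S, F x ∈ S) →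
      F '' S = S := by
    intro X F S hF hS
    refine Set.Subset.antisymm (Set.image_subset_iff.2 hS) fun x hx => ⟨F x, hS x hx, ?_⟩
    exact congrFun hF x
  have edge_flag : ∀ f ∈ K.faces, ∀ e ∈ f, ∃ Ψ : K.Flag, Ψ.edge = e ∧ Ψ.face = f := by
    intro f hf e he
    have heK := K.face_subset_edges f hf he
    induction e using Sym2.ind with
    | _ a b =>
      exact ⟨⟨a, s(a, b), f, K.mem_vertices_of_mem_edge _ heK a (by simp), heK, hf, by simp, he⟩,
        rfl, rfl⟩
  refine ⟨image_eq ?_ ?_, image_eq ?_ ?_, image_eq ?_ ?_⟩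
  · rw [← Equiv.Perm.coe_mul, ← onPoint_mul, hσ, onPoint_one, Equiv.Perm.coe_one]
  · intro x hx
    obtain ⟨Ψ, rfl⟩ := hvert x hx
    exact (key Ψ).1
  · rw [← onEdge_mul, hσ, onEdge_one]
  · intro e he
    obtain ⟨f, hf, hef⟩ := exists_face_of_edge he
    obtain ⟨Ψ, rfl, -⟩ := edge_flag f hf e hef
    exact (key Ψ).2.1
  · rw [← onFace_mul, hσ, onFace_one]
  · intro f hf
    obtain ⟨e, he⟩ := exists_edge_of_face hinf hf
    obtain ⟨Ψ, -, rfl⟩ := edge_flag f hf e he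
    exact (key Ψ).2.2

theorem eq_one_of_mapsFlag (hsimple : K.IsSimplyFlagTransitive) {g : K.hull ≃ᵢ K.hull}
    (hg : g ∈ K.symmetryGroup) {Φ : K.Flag} (hm : K.MapsFlag g Φ Φ) : g = 1 :=
  (hsimple Φ Φ).unique ⟨hg, hm⟩ ⟨one_mem _, MapsFlag.one Φ⟩

theorem onFace_range (g : K.hull ≃ᵢ K.hull) (v : ℤ → E3) :
    K.onFace g (Set.range fun i => s(v i, v (i + 1))) =
      Set.range fun i => s(K.onPoint g (v i), K.onPoint g (v (i + 1))) := by
  rw [onFace, ← Set.range_comp]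
  rfl

/-- The involution `R₀` reverses the base edge. -/
theorem generator_zero_swaps (hreg : K.IsRegular) (hsimple : K.IsSimplyFlagTransitive)
    {Φ : K.Flag} {R : K.hull ≃ᵢ K.hull} (hR : K.G₀ Φ = Subgroup.zpowers R) {w : E3}
    (he : Φ.edge = s(Φ.vertex, w)) :
    K.onPoint R Φ.vertex = w ∧ K.onPoint R w = Φ.vertex ∧ R * R = 1 := by
  have hRG : R ∈ K.G₀ Φ := hR ▸ Subgroup.mem_zpowers R
  have hedge : s(K.onPoint R Φ.vertex, K.onPoint R w) = s(Φ.vertex, w) := by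
    have := hRG.2.1
    rw [he] at this
    exact this
  have hww : w ≠ Φ.vertex := by
    intro h
    apply K.edge_not_isDiag _ Φ.edge_mem
    rw [he, h]
    simp
  have hsw : K.onPoint R Φ.vertex = w ∧ K.onPoint R w = Φ.vertex := by
    rcases Sym2.eq_iff.1 hedge with ⟨h, -⟩ | h
    · exfalso
      have hR1 : R = 1 := eq_one_of_mapsFlag hsimple hRG.1 ⟨h, hRG.2⟩
      have hwe : w ∈ Φ.edge := by rw [he]; simp
      obtain ⟨g, hg, hm⟩ := hreg Φ ⟨w, Φ.edge, Φ.face,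
        K.mem_vertices_of_mem_edge _ Φ.edge_mem w hwe, Φ.edge_mem, Φ.face_mem, hwe,
        Φ.edge_mem_face⟩
      have hgG : g ∈ K.G₀ Φ := ⟨hg, hm.2⟩
      rw [hR, hR1, Subgroup.zpowers_one_eq_bot, Subgroup.mem_bot] at hgG
      have := hm.1
      rw [hgG, onPoint_one] at this
      exact hww this.symm
    · exact h
  refine ⟨hsw.1, hsw.2, eq_one_of_mapsFlag hsimple (mul_mem hRG.1 hRG.1) (Φ := Φ) ⟨?_, ?_, ?_⟩⟩
  · rw [onPoint_mul, Equiv.Perm.mul_apply, hsw.1, hsw.2]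
  · rw [onEdge_mul, Function.comp_apply, hRG.2.1, hRG.2.1]
  · rw [onFace_mul, Function.comp_apply, hRG.2.2, hRG.2.2]

/-- The generator `R₁` interchanges the two edges of the base face at the base vertex. -/
theorem generator_one_swaps (hreg : K.IsRegular) (hsimple : K.IsSimplyFlagTransitive)
    {Φ : K.Flag} {R : K.hull ≃ᵢ K.hull} (hR : K.G₁ Φ = Subgroup.zpowers R) {v : ℤ → E3}
    (hv : Function.Injective v) (hf : Φ.face = Set.range fun i => s(v i, v (i + 1)))
    (hv0 : v 0 = Φ.vertex) (he : Φ.edge = s(v 0, v 1)) :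
    R ≠ 1 ∧ K.onPoint R (v 1) = v (-1) := by
  have hRG : R ∈ K.G₁ Φ := hR ▸ Subgroup.mem_zpowers R
  have hR1 : R ≠ 1 := by
    intro h
    have hef : s(v 0, v (-1)) ∈ Φ.face := by
      rw [hf]
      exact ⟨-1, by rw [Sym2.eq_swap]; rfl⟩
    obtain ⟨g, hg, hm⟩ := hreg Φ ⟨Φ.vertex, s(v 0, v (-1)), Φ.face, Φ.vertex_mem,
      K.face_subset_edges _ Φ.face_mem hef, Φ.face_mem, by simp [hv0], hef⟩
    have hgG : g ∈ K.G₁ Φ := ⟨hg, hm.1, hm.2.2⟩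
    rw [hR, h, Subgroup.zpowers_one_eq_bot, Subgroup.mem_bot] at hgG
    have := hm.2.1
    rw [hgG, onEdge_one, id, he] at this
    have h' : v 1 = v (-1) ∨ v 0 = v (-1) ∧ v 1 = v 0 := by simpa using this
    rcases h' with h' | ⟨h', -⟩
    · have := hv h'
      omega
    · have := hv h'
      omega
  refine ⟨hR1, ?_⟩
  have hmem : s(K.onPoint R (v 0), K.onPoint R (v 1)) ∈ Φ.face := by
    have h := hRG.2.2
    rw [hf, onFace_range, ← hf] at h
    rw [← h]
    exact ⟨0, by simp⟩
  have h0 : K.onPoint R (v 0) = v 0 := by rw [hv0]; exact hRG.2.1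
  rw [h0, hf] at hmem
  obtain ⟨j, hj⟩ := hmem
  rcases Sym2.eq_iff.1 hj with ⟨h1, h2⟩ | ⟨h1, h2⟩
  · exfalso
    have hj0 := hv h1
    rw [hj0, zero_add] at h2
    refine hR1 (eq_one_of_mapsFlag hsimple hRG.1 (Φ := Φ) ⟨hRG.2.1, ?_, hRG.2.2⟩)
    rw [he]
    change s(K.onPoint R (v 0), K.onPoint R (v 1)) = _
    rw [h0, ← h2]
  · have hj0 := hv h2
    rw [← h1]
    congr 1
    omega

/-- The point reflection in the midpoint of a segment commutes with the isometries that map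
the segment to itself. -/
theorem onPoint_add_sub {g : K.hull ≃ᵢ K.hull} {A : E3 ≃ₗᵢ[ℝ] E3}
    (hA : ∀ x y, K.onPoint g x - K.onPoint g y = A (x - y)) {a b : E3}
    (hab : K.onPoint g a + K.onPoint g b = a + b) (x : E3) :
    K.onPoint g (a + b - x) = a + b - K.onPoint g x := by
  have h1 := hA (a + b - x) a
  have h2 := hA b x
  rw [show a + b - x - a = b - x by abel, ← h2] at h1
  rw [eq_add_of_sub_eq h1, ← hab]
  abel

/-- If the axis of the half-turn `R₀` were not parallel to the mirror of `R₁`, then the base face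
would lie on a sphere. -/
theorem vectorSpan_mirror_le (hK : K.hull = ⊤) {R₀ R₁ : K.hull ≃ᵢ K.hull}
    (hd0 : K.HasMirrorDim R₀ 1) (hd1 : K.HasMirrorDim R₁ 2) {v : ℤ → E3}
    (hcpt : ∀ C : Set E3, IsCompact C → {i : ℤ | v i ∈ C}.Finite)
    (h0 : ∀ i, K.onPoint R₀ (v i) = v (1 - i)) (h1 : ∀ i, K.onPoint R₁ (v i) = v (-i)) :
    vectorSpan ℝ (K.mirror R₀) ≤ vectorSpan ℝ (K.mirror R₁) := by
  by_contra hle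
  obtain ⟨A, hA⟩ := exists_linear_part hK R₀
  obtain ⟨B, hB⟩ := exists_linear_part hK R₁
  have hU := mem_vectorSpan_mirror_iff hK hd0.1 hA
  have hW := mem_vectorSpan_mirror_iff hK hd1.1 hB
  have hsup : vectorSpan ℝ (K.mirror R₁) ⊔ vectorSpan ℝ (K.mirror R₀) = ⊤ := by
    apply Submodule.eq_top_of_finrank_eq
    have hlt := Submodule.finrank_lt_finrank_of_lt (left_lt_sup.2 hle)
    have hle' := Submodule.finrank_le (vectorSpan ℝ (K.mirror R₁) ⊔ vectorSpan ℝ (K.mirror R₀))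
    rw [hd1.2] at hlt
    rw [finrank_euclideanSpace_fin] at hle' ⊢
    omega
  obtain ⟨q, hq⟩ := hd0.1
  rw [mem_mirror_iff hK] at hq
  have hmem : q - v 0 ∈ vectorSpan ℝ (K.mirror R₁) ⊔ vectorSpan ℝ (K.mirror R₀) := by
    rw [hsup]
    trivial
  obtain ⟨w, hw, u, hu, hwu⟩ := Submodule.mem_sup.1 hmem
  rw [hU] at hu
  rw [hW] at hw
  have hv0 : K.onPoint R₁ (v 0) = v 0 := by simpa using h1 0
  have hp1 : K.onPoint R₁ (v 0 + w) = v 0 + w := by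
    have := hB (v 0 + w) (v 0)
    rw [add_sub_cancel_left, hw, hv0] at this
    rw [eq_add_of_sub_eq this, add_comm]
  have hp0 : K.onPoint R₀ (v 0 + w) = v 0 + w := by
    have := hA q (v 0 + w)
    have e : q - (v 0 + w) = u := by rw [← sub_sub, ← hwu]; abel
    rw [e, hu, hq, ← e] at this
    exact sub_right_injective this
  have hdist : ∀ i, dist (v i) (v 0 + w) = dist (v 0) (v 0 + w) := by
    refine Int.forall_of_neg_of_one_sub rfl ?_ ?_
    · intro i hi
      rw [← hi, ← h1, ← dist_onPoint hK R₁ (v i), hp1]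
    · intro i hi
      rw [← hi, ← h0, ← dist_onPoint hK R₀ (v i), hp0]
  have hfin := hcpt _ (isCompact_closedBall (v 0 + w) (dist (v 0) (v 0 + w)))
  have huniv : {i : ℤ | v i ∈ Metric.closedBall (v 0 + w) (dist (v 0) (v 0 + w))} = Set.univ :=
    Set.eq_univ_of_forall fun i => (hdist i).le
  rw [huniv] at hfin
  exact Set.infinite_univ hfin

/-- The faces of a regular complex with infinite faces and mirror vector `(1, 2)` are planar
zigzags, and the reflection in the plane of the base face is a symmetry of the complex. It fixes the
base flag, and it normalizes the group generated by `R₀`, `R₁` and the pointwise stabilizer of the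
base edge. -/
theorem exists_ne_one_mapsFlag (hreg : K.IsRegular) (hsimple : K.IsSimplyFlagTransitive)
    (hinf : K.HasInfiniteFaces) (hmirror : K.HasMirrorVector 1 2) :
    ∃ (Φ : K.Flag) (σ : K.hull ≃ᵢ K.hull), σ ∈ K.symmetryGroup ∧ K.MapsFlag σ Φ Φ ∧ σ ≠ 1 := by
  obtain ⟨Φ, R₀, R₁, hG0, hG1, hd0, hd1⟩ := hmirror
  obtain ⟨v, hv, hcpt, hf, hv0, he⟩ :=
    (hinf _ Φ.face_mem).exists_param Φ.vertex_mem_edge Φ.edge_mem_face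
  have hR0 : R₀ ∈ K.G₀ Φ := hG0 ▸ Subgroup.mem_zpowers R₀
  have hR1 : R₁ ∈ K.G₁ Φ := hG1 ▸ Subgroup.mem_zpowers R₁
  obtain ⟨h01, h10, hinv⟩ := generator_zero_swaps hreg hsimple hG0 (w := v 1) (by rw [he, hv0])
  obtain ⟨hne, h1m⟩ := generator_one_swaps hreg hsimple hG1 hv hf hv0 he
  rw [← hv0] at h01 h10
  have h00 : K.onPoint R₁ (v 0) = v 0 := by rw [hv0]; exact hR1.2.1
  have hK := hull_eq_top_of_hasMirrorDim_two hne hd1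
  have hface : ∀ g : K.hull ≃ᵢ K.hull, K.onFace g Φ.face = Φ.face →
      Set.range (fun i => s(v i, v (i + 1))) ⊆
        Set.range fun i => s(K.onPoint g (v i), K.onPoint g (v (i + 1))) := by
    intro g hg
    rw [hf, onFace_range] at hg
    rw [hg]
  have act0 : ∀ i, K.onPoint R₀ (v i) = v (1 - i) := by
    intro i
    refine (congrFun (int_path_unique (v := fun i => K.onPoint R₀ (v i)) (w := fun i => v (1 - i))
      ((K.onPoint R₀).injective.comp hv) (fun i j h => by simpa using hv h)
      (subset_trans ?_ (hface R₀ hR0.2.2)) (by simp [h01]) (by simp [h10])) i).symm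
    rintro _ ⟨i, rfl⟩
    refine ⟨-i, ?_⟩
    beta_reduce
    rw [Sym2.eq_swap]
    ring_nf
  have act1 : ∀ i, K.onPoint R₁ (v i) = v (-i) := by
    intro i
    refine (congrFun (int_path_unique (v := fun i => K.onPoint R₁ (v i)) (w := fun i => v (-i))
      ((K.onPoint R₁).injective.comp hv) (fun i j h => by simpa using hv h)
      (subset_trans ?_ (hface R₁ hR1.2.2)) (by simp [h00]) (by simp [h1m])) i).symm
    rintro _ ⟨i, rfl⟩
    refine ⟨-i - 1, ?_⟩
    beta_reduce
    rw [Sym2.eq_swap]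
    ring_nf
  have hUW := vectorSpan_mirror_le hK hd0 hd1 hcpt act0 act1
  obtain ⟨A, hA⟩ := exists_linear_part hK R₀
  obtain ⟨B, hB⟩ := exists_linear_part hK R₁
  have hU := mem_vectorSpan_mirror_iff hK hd0.1 hA
  have hW := mem_vectorSpan_mirror_iff hK hd1.1 hB
  have hinv' : ∀ x, K.onPoint R₀ (K.onPoint R₀ x) = x := by
    intro x
    rw [← Equiv.Perm.mul_apply, ← onPoint_mul, hinv, onPoint_one, Equiv.Perm.coe_one, id]
  have hAA : ∀ x, A (A x) = x := by
    intro x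
    have h := hA x 0
    rw [sub_zero] at h
    rw [← h, ← hA, hinv', hinv', sub_zero]
  have hBW : ∀ x, B x - x ∈ (vectorSpan ℝ (K.mirror R₁))ᗮ := by
    intro x
    have h : B x - x = K.onPoint R₁ (v 0 + x) - (v 0 + x) := by
      have := hB (v 0 + x) (v 0)
      rw [add_sub_cancel_left, h00] at this
      rw [← this]
      abel
    rw [h]
    apply sub_mem_orthogonal_vectorSpan
    intro p hp
    rw [mem_mirror_iff hK] at hp
    rw [← dist_onPoint hK R₁ (v 0 + x), hp]
  have hAB := involution_comm hAA hU (fun x hx => (hW x).1 hx) hBW hUW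
  have hsum0 : K.onPoint R₀ (v 0) + K.onPoint R₀ (v 1) = v 0 + v 1 := by rw [h01, h10, add_comm]
  obtain ⟨σ, hσ⟩ := exists_onPoint_eq hK
    (IsometryEquiv.trans ⟨K.onPoint R₀, Isometry.of_dist_eq (dist_onPoint hK R₀)⟩
      (IsometryEquiv.subLeft (v 0 + v 1)))
  replace hσ : ∀ x, K.onPoint σ x = v 0 + v 1 - K.onPoint R₀ x := hσ
  have ext_iff : ∀ {g h : K.hull ≃ᵢ K.hull}, (∀ x, K.onPoint g x = K.onPoint h x) → g = h :=
    fun h => onPoint_injective (Equiv.ext h)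
  have hσσ : σ * σ = 1 := by
    refine ext_iff fun x => ?_
    rw [onPoint_mul, Equiv.Perm.mul_apply, hσ, hσ, onPoint_add_sub hA hsum0, hinv', onPoint_one,
      Equiv.Perm.coe_one, id]
    abel
  have hσ' : σ⁻¹ = σ := inv_eq_of_mul_eq_one_left hσσ
  have comm0 : Commute σ R₀ := by
    refine ext_iff fun x => ?_
    rw [onPoint_mul, onPoint_mul, Equiv.Perm.mul_apply, Equiv.Perm.mul_apply, hσ, hσ,
      onPoint_add_sub hA hsum0]
  have comm1 : Commute σ R₁ := by
    refine ext_iff fun x => ?_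
    rw [onPoint_mul, onPoint_mul, Equiv.Perm.mul_apply, Equiv.Perm.mul_apply, hσ, hσ]
    have e1 := hA (K.onPoint R₁ x) (K.onPoint R₁ (v 0))
    have e2 := hB (v 0 + v 1 - K.onPoint R₀ x) (v 0)
    have e3 : v 0 + v 1 - K.onPoint R₀ x - v 0 = -A (x - v 0) := by rw [← hA, h01]; abel
    rw [hB, h00, h01, hAB] at e1
    rw [e3, map_neg, h00, ← e1] at e2
    rw [eq_add_of_sub_eq e2]
    abel
  have conj : ∀ g : K.hull ≃ᵢ K.hull, K.onPoint g Φ.vertex = Φ.vertex →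
      K.onEdge g Φ.edge = Φ.edge → σ * g * σ⁻¹ = R₀ * g * R₀ := by
    intro g hg hge
    rw [← hv0] at hg
    have hg1 : K.onPoint g (v 1) = v 1 := by
      rw [he] at hge
      change s(K.onPoint g (v 0), K.onPoint g (v 1)) = _ at hge
      rcases Sym2.eq_iff.1 hge with ⟨-, h⟩ | ⟨h, h'⟩
      · exact h
      · rw [h', ← hg, h]
    obtain ⟨C, hC⟩ := exists_linear_part hK g
    refine ext_iff fun x => ?_
    rw [hσ']
    simp only [onPoint_mul, Equiv.Perm.mul_apply]
    rw [hσ, hσ, onPoint_add_sub hC (by rw [hg, hg1]), onPoint_add_sub hA hsum0]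
    abel
  have fix : ∀ i, K.onPoint σ (v i) = v i := by
    refine Int.forall_of_neg_of_one_sub ?_ ?_ ?_
    · rw [hσ, h01, add_sub_cancel_right]
    · intro i hi
      rw [← act1, ← Equiv.Perm.mul_apply, ← onPoint_mul, comm1.eq, onPoint_mul,
        Equiv.Perm.mul_apply, hi]
    · intro i hi
      rw [← act0, ← Equiv.Perm.mul_apply, ← onPoint_mul, comm0.eq, onPoint_mul,
        Equiv.Perm.mul_apply, hi]
  have hflag : K.MapsFlag σ Φ Φ := by
    refine ⟨?_, ?_, ?_⟩
    · rw [← hv0, fix]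
    · rw [he]
      change s(K.onPoint σ (v 0), K.onPoint σ (v 1)) = _
      rw [fix, fix]
    · rw [hf, onFace_range]
      simp only [fix]
  refine ⟨Φ, σ, mem_symmetryGroup_of_conj hreg hinf hσσ hflag ?_ ?_ ?_, hflag, ?_⟩
  · intro g hg
    have hg' := hg
    rw [hG0] at hg'
    obtain ⟨k, rfl⟩ := hg'
    rw [(comm0.zpow_right k).eq, mul_inv_cancel_right]
    exact hg.1
  · intro g hg
    have hg' := hg
    rw [hG1] at hg'
    obtain ⟨k, rfl⟩ := hg'
    rw [(comm1.zpow_right k).eq, mul_inv_cancel_right]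
    exact hg.1
  · intro g hg hgv hge
    rw [conj g hgv hge]
    exact mul_mem (mul_mem hR0.1 hg) hR0.1
  · intro h
    have hbot : vectorSpan ℝ (K.mirror R₀) = ⊥ := by
      rw [Submodule.eq_bot_iff]
      intro u hu
      rw [hU] at hu
      have e := hA u 0
      have h' : ∀ x, K.onPoint R₀ x = v 0 + v 1 - x := by
        intro x
        have := hσ x
        rw [h, onPoint_one, Equiv.Perm.coe_one, id] at this
        rw [eq_sub_iff_add_eq, add_comm]
        exact (eq_sub_iff_add_eq.1 this)
      rw [h', h', sub_zero, sub_zero, hu] at e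
      rw [sub_sub_cancel_left] at e
      have h2 : (2 : ℝ) • u = 0 := by
        rw [two_smul]
        nth_rewrite 1 [← e]
        rw [neg_add_cancel]
      exact (smul_eq_zero.1 h2).resolve_left two_ne_zero
    have := hd0.2
    rw [hbot, finrank_bot] at this
    exact zero_ne_one this

end PolygonalComplex

theorem mainTheorem4 (K : PolygonalComplex) (hreg : K.IsRegular)
    (hsimple : K.IsSimplyFlagTransitive) (hinf : K.HasInfiniteFaces)
    (hmirror : K.HasMirrorVector 1 2) : K.IsPolyhedron := by
  obtain ⟨Φ, σ, hσ, hm, hne⟩ := K.exists_ne_one_mapsFlag hreg hsimple hinf hmirror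
  exact absurd (K.eq_one_of_mapsFlag hsimple hσ hm) hne
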